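/- Consider $n\ge 0$ uses of a point-to-point channel with additive-noise feedback. The message $M$ and the feedback noise $V^n=(V_1,\dots,V_n)$ are independent. At each time $i=1,\dots,n$ the transmitter sends $X_i=e_i(M,Y_1+V_1,\dots,Y_{i-1}+V_{i-1})$ for some measurable function $e_i$, that is, the input is determined by the message and the past outputs of the feedback link. The channel then produces $Y_i$ according to a transition probability $p_i(\,\cdot\mid X^i,Y^{i-1})$; that is, given $(M,V^n,X^i,Y^{i-1})$, the conditional law of $Y_i$ is $p_i(\,\cdot\mid X^i,Y^{i-1})$. The transition probabilities and the laws of $M$ and $V^n$ are arbitrary (not necessarily Gaussian). The outputs and the feedback noise take values in $\mathbb{R}$, or more generally in a standard Borel space that is an abelian group with measurable addition; messages and inputs take values in arbitrary measurable spaces. Let $I(\cdot\,;\cdot)$ and $I(\cdot\,;\cdot\mid\cdot)$ denote mutual information and conditional mutual information, with logarithms to base $2$ and values in $[0,\infty]$ (defined as the relative entropy of the joint law with respect to the law under which the two variables are independent, respectively conditionally independent, with the same marginals), and let $$I(X^n\to Y^n)=\sum_{i=1}^n I(X^i;Y_i\mid Y^{i-1}),\qquad I(X^n\to Y^n\mid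 V^n)=\sum_{i=1}^n I(X^i;Y_i\mid Y^{i-1},V^n).$$ Then $$I(M;Y^n)\le I(X^n\to Y^n\mid V^n)\le I(X^n\to Y^n)\le I(X^n;Y^n).$$ If the feedback is ideal ($V^n=0$ almost surely), the first two inequalities are equalities. If there is no feedback (every $X_i$ is almost surely a measurable function of $M$ alone), the last inequality is an equality. -/

import Mathlib

open MeasureTheory ProbabilityTheory
open scoped ENNReal

namespace NoisyFeedback

noncomputable section

/-- The mutual information `I(A; B)` in bits, with values in `[0, ∞]`: the relative entropy of the
joint law of `(A, B)` with respect to the product of the marginal laws.  If the joint law has a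
density `f` with respect to a product of σ-finite measures, this is
`∫ f log₂ (f(a, b) / (f(a) f(b)))`. -/
def mutualInfo {Ω α β : Type*} [MeasurableSpace Ω] [MeasurableSpace α] [MeasurableSpace β]
    (A : Ω → α) (B : Ω → β) (P : Measure Ω) : ℝ≥0∞ :=
  InformationTheory.klDiv (P.map (fun ω => (A ω, B ω))) ((P.map A).prod (P.map B))
    / ENNReal.ofReal (Real.log 2)

/-- The conditional mutual information `I(A; B | C)` in bits, with values in `[0, ∞]`: the relative
entropy of the joint law of `((C, A), B)` with respect to `P_{C,A} ⊗ P_{B|C}`, the law under which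
`(C, A)` and `(C, B)` have the same distributions but `A` and `B` are conditionally independent
given `C`. -/
def condMutualInfo {Ω α β γ : Type*} [MeasurableSpace Ω] [MeasurableSpace α]
    [MeasurableSpace β] [StandardBorelSpace β] [Nonempty β] [MeasurableSpace γ]
    (A : Ω → α) (B : Ω → β) (C : Ω → γ) (P : Measure Ω) [IsFiniteMeasure P] : ℝ≥0∞ :=
  InformationTheory.klDiv (P.map (fun ω => ((C ω, A ω), B ω)))
      ((P.map (fun ω => (C ω, A ω))) ⊗ₘ ((condDistrib B C P).prodMkRight α))
    / ENNReal.ofReal (Real.log 2)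

/-- The initial segment of the sequence `X` up to and including time `i`. -/
def upTo {Ω 𝒳 : Type*} {n : ℕ} (X : Fin n → Ω → 𝒳) (i : Fin n) : Ω → Set.Iic i → 𝒳 :=
  fun ω j => X j ω

/-- The initial segment of the sequence `Y` strictly before time `i`. -/
def before {Ω 𝒴 : Type*} {n : ℕ} (Y : Fin n → Ω → 𝒴) (i : Fin n) : Ω → Set.Iio i → 𝒴 :=
  fun ω j => Y j ω

/-- The whole sequence as one random vector. -/
def block {Ω 𝒴 : Type*} {n : ℕ} (Y : Fin n → Ω → 𝒴) : Ω → Fin n → 𝒴 :=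
  fun ω j => Y j ω

/-- The directed information `I(Xⁿ → Yⁿ) = ∑ᵢ I(Xⁱ; Yᵢ | Yⁱ⁻¹)`. -/
def directedInfo {Ω 𝒳 𝒴 : Type*} [MeasurableSpace Ω] [MeasurableSpace 𝒳]
    [MeasurableSpace 𝒴] [StandardBorelSpace 𝒴] [Nonempty 𝒴] {n : ℕ}
    (X : Fin n → Ω → 𝒳) (Y : Fin n → Ω → 𝒴) (P : Measure Ω) [IsFiniteMeasure P] : ℝ≥0∞ :=
  ∑ i, condMutualInfo (upTo X i) (Y i) (before Y i) P

/-- The conditional directed information `I(Xⁿ → Yⁿ | V) = ∑ᵢ I(Xⁱ; Yᵢ | Yⁱ⁻¹, V)`. -/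
def condDirectedInfo {Ω 𝒳 𝒴 γ : Type*} [MeasurableSpace Ω] [MeasurableSpace 𝒳]
    [MeasurableSpace 𝒴] [StandardBorelSpace 𝒴] [Nonempty 𝒴] [MeasurableSpace γ] {n : ℕ}
    (X : Fin n → Ω → 𝒳) (Y : Fin n → Ω → 𝒴) (V : Ω → γ) (P : Measure Ω) [IsFiniteMeasure P] :
    ℝ≥0∞ :=
  ∑ i, condMutualInfo (upTo X i) (Y i) (fun ω => (before Y i ω, V ω)) P

/-- `n` uses of a point-to-point channel with additive-noise feedback.

* The channel is a family of transition kernels `κ i` (arbitrary, possibly with memory): at time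
  `i` it produces its output at random from the inputs `Xⁱ` and the previous outputs `Yⁱ⁻¹`.
* The feedback link returns `Yⱼ + Vⱼ`, and at time `i` the transmitter has received these values
  for all `j < i`; it computes the input `Xᵢ` from them and the message `M` by means of `enc i`.
* The message and the feedback noise `Vⁿ` come from outside of the channel: they are independent,
  and they act on an output only through the input of the channel. -/
structure IsFeedbackChannel {Ω 𝓜 𝒳 𝒴 : Type*} [MeasurableSpace Ω] [MeasurableSpace 𝓜]
    [MeasurableSpace 𝒳] [MeasurableSpace 𝒴] [AddCommGroup 𝒴] {n : ℕ}
    (κ : ∀ i : Fin n, Kernel ((Set.Iic i → 𝒳) × (Set.Iio i → 𝒴)) 𝒴)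
    (enc : ∀ i : Fin n, 𝓜 × (Set.Iio i → 𝒴) → 𝒳)
    (M : Ω → 𝓜) (X : Fin n → Ω → 𝒳) (Y V : Fin n → Ω → 𝒴) (P : Measure Ω) : Prop where
  measurable_enc : ∀ i, Measurable (enc i)
  measurable_message : Measurable M
  measurable_input : ∀ i, Measurable (X i)
  measurable_output : ∀ i, Measurable (Y i)
  measurable_noise : ∀ i, Measurable (V i)
  message_indep_noise : IndepFun M (block V) P
  input_eq : ∀ i, ∀ᵐ ω ∂P, X i ω = enc i (M ω, before Y i ω + before V i ω)
  output_law : ∀ i, HasCondDistrib (Y i)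
    (fun ω => ((M ω, block V ω), (upTo X i ω, before Y i ω))) ((κ i).prodMkLeft _) P

/-- There is no feedback: every channel input is computed from the message alone. -/
def WithoutFeedback {Ω 𝓜 𝒳 : Type*} [MeasurableSpace Ω] [MeasurableSpace 𝓜] [MeasurableSpace 𝒳]
    {n : ℕ} (M : Ω → 𝓜) (X : Fin n → Ω → 𝒳) (P : Measure Ω) : Prop :=
  ∃ g : Fin n → 𝓜 → 𝒳, (∀ i, Measurable (g i)) ∧ ∀ i, ∀ᵐ ω ∂P, X i ω = g i (M ω)

end

end NoisyFeedback

-- Write `I(A; B | C)` as the mean relative entropy of the law of `B` given `(C, A)` from the law of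
-- `B` given `C`. If `(C, A)` determines `(Xⁱ, Yⁱ⁻¹)` and is itself a function of `M`, `Vⁿ`, `Xⁱ`,
-- `Yⁱ⁻¹`, the first of these laws is that of the channel (`IsFeedbackChannel.condMutualInfo_eq`).
-- So the information about `Yᵢ` given `C` is the same for all such `A`.
--
-- By the chain rule and the independence of `M` and `Vⁿ`, `I(M; Yⁿ, Vⁿ) = ∑ᵢ I(M; Yᵢ | Yⁱ⁻¹, Vⁿ)`.
-- Given `(Yⁱ⁻¹, Vⁿ)` the encoder recovers `Xⁱ` from `M`, so `M` may be replaced by `Xⁱ`, and the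
-- sum is `I(Xⁿ → Yⁿ | Vⁿ)`. Dropping `Vⁿ` gives the first inequality. For the second, `I(Xⁱ; Yᵢ |
-- Yⁱ⁻¹, Vⁿ) ≤ I(Xⁱ, Vⁿ; Yᵢ | Yⁱ⁻¹) = I(Xⁱ; Yᵢ | Yⁱ⁻¹)`. The third is the chain rule for `I(Xⁿ; Yⁿ)`
-- with data processing from `Xⁿ` to `Xⁱ`.

namespace InformationTheory

-- Relative entropy of kernels and measures.

lemma klDiv_compProd_right_eq_lintegral {α β : Type*} {mα : MeasurableSpace α}
    {mβ : MeasurableSpace β} [MeasurableSpace.CountableOrCountablyGenerated α β]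
    (μ : Measure α) (κ η : Kernel α β) [IsFiniteMeasure μ] [IsFiniteKernel κ] [IsFiniteKernel η] :
    klDiv (μ ⊗ₘ κ) (μ ⊗ₘ η) = ∫⁻ a, klDiv (κ a) (η a) ∂μ := by
  by_cases h : ∀ᵐ a ∂μ, κ a ≪ η a
  · have hm : Measurable (Function.uncurry (κ.rnDeriv η)) := κ.measurable_rnDeriv η
    -- The density of the joint measures is the fibrewise density.
    have hd : μ ⊗ₘ κ = (μ ⊗ₘ η).withDensity (Function.uncurry (κ.rnDeriv η)) := by
      refine Eq.trans (Measure.compProd_congr ?_) (Measure.compProd_withDensity hm)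
      filter_upwards [h] with a ha using (Kernel.withDensity_rnDeriv_eq ha).symm
    have hr : (μ ⊗ₘ κ).rnDeriv (μ ⊗ₘ η) =ᵐ[μ ⊗ₘ η] Function.uncurry (κ.rnDeriv η) := by
      rw [hd]
      exact Measure.rnDeriv_withDensity _ hm
    rw [klDiv_eq_lintegral_klFun_of_ac (Measure.AbsolutelyContinuous.compProd_right h),
      lintegral_congr_ae (hr.mono fun p hp ↦ by rw [hp]), Measure.lintegral_compProd (by fun_prop)]
    refine lintegral_congr_ae ?_
    filter_upwards [h] with a ha
    rw [klDiv_eq_lintegral_klFun_of_ac ha]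
    refine lintegral_congr_ae ?_
    filter_upwards [Kernel.rnDeriv_eq_rnDeriv_measure (κ := κ) (η := η) (a := a)] with b hb
    simp [Function.uncurry, hb]
  -- Otherwise absolute continuity fails on a set of fibres of positive measure, and both sides are
  -- infinite.
  · rw [klDiv_of_not_ac fun hac ↦ h hac.kernel_of_compProd, eq_comm, eq_top_iff]
    have hs : MeasurableSet {a | ¬ κ a ≪ η a} :=
      (Kernel.measurableSet_absolutelyContinuous κ η).compl
    calc (∞ : ℝ≥0∞) = ∫⁻ _ in {a | ¬ κ a ≪ η a}, ∞ ∂μ := by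
          rw [setLIntegral_const, ENNReal.top_mul (by rwa [ae_iff] at h)]
      _ ≤ ∫⁻ a in {a | ¬ κ a ≪ η a}, klDiv (κ a) (η a) ∂μ :=
          setLIntegral_mono' hs fun a ha ↦ (klDiv_of_not_ac ha).ge
      _ ≤ ∫⁻ a, klDiv (κ a) (η a) ∂μ := setLIntegral_le_lintegral _ _

/-- The jointly measurable density of `κ` against `η` expresses the divergence as a parametric
integral, on the measurable set of fibres where it is not trivially infinite. -/
lemma measurable_klDiv_kernel {α β : Type*} {mα : MeasurableSpace α}
    {mβ : MeasurableSpace β} [MeasurableSpace.CountableOrCountablyGenerated α β]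
    (κ η : Kernel α β) [IsFiniteKernel κ] [IsFiniteKernel η] :
    Measurable fun a ↦ klDiv (κ a) (η a) := by
  classical
  have h : (fun a ↦ klDiv (κ a) (η a)) = fun a ↦ if κ a ≪ η a then
      ∫⁻ b, ENNReal.ofReal (klFun (κ.rnDeriv η a b).toReal) ∂(η a) else ∞ := by
    ext a
    rw [klDiv_eq_lintegral_klFun]
    congr 1
    refine lintegral_congr_ae ?_
    filter_upwards [Kernel.rnDeriv_eq_rnDeriv_measure (κ := κ) (η := η) (a := a)] with b hb
    rw [hb]
  rw [h]
  refine Measurable.ite (Kernel.measurableSet_absolutelyContinuous κ η) ?_ measurable_const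
  refine Measurable.lintegral_kernel_prod_right ?_
  have := κ.measurable_rnDeriv η
  simp only [Function.uncurry_def]
  fun_prop

/-- Correcting the reference measure `ν` by the density of the image of `μ` with respect to the
image of `ν` does not increase the relative entropy. -/
lemma klDiv_withDensity_le {α β : Type*} {mα : MeasurableSpace α} {mβ : MeasurableSpace β}
    (μ ν : Measure α) [IsProbabilityMeasure μ] [IsProbabilityMeasure ν] {g : α → β}
    (hg : Measurable g) {h : β → ℝ≥0∞} (hh : Measurable h)
    (hd : μ.map g = (ν.map g).withDensity h) :
    klDiv μ (ν.withDensity (h ∘ g)) ≤ klDiv μ ν := by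
  by_cases htop : klDiv μ ν = ∞
  · simp [htop]
  obtain ⟨hac, hint⟩ := klDiv_ne_top_iff.1 htop
  have : IsProbabilityMeasure (μ.map g) := Measure.isProbabilityMeasure_map hg.aemeasurable
  have : IsProbabilityMeasure (ν.map g) := Measure.isProbabilityMeasure_map hg.aemeasurable
  have hmg : Measurable (h ∘ g) := hh.comp hg
  set ρ := ν.withDensity (h ∘ g) with hρ
  have hr : (μ.map g).rnDeriv (ν.map g) =ᵐ[ν.map g] h := by
    rw [hd]
    exact Measure.rnDeriv_withDensity _ hh
  have hr' : (fun a ↦ (μ.map g).rnDeriv (ν.map g) (g a)) =ᵐ[μ] h ∘ g :=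
    hac.ae_le (ae_of_ae_map hg.aemeasurable hr)
  have hpos : ∀ᵐ a ∂μ, 0 < (μ.map g).rnDeriv (ν.map g) (g a) :=
    ae_of_ae_map hg.aemeasurable (Measure.rnDeriv_pos (hac.map hg))
  have hlt : ∀ᵐ a ∂μ, (μ.map g).rnDeriv (ν.map g) (g a) < ∞ :=
    ae_of_ae_map hg.aemeasurable ((hac.map hg).ae_le (Measure.rnDeriv_lt_top _ _))
  have hρ_univ : ρ Set.univ = 1 := by
    rw [hρ, withDensity_apply _ .univ, setLIntegral_univ]
    calc ∫⁻ a, (h ∘ g) a ∂ν = ∫⁻ b, h b ∂(ν.map g) := (lintegral_map hh hg).symm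
      _ = (μ.map g) Set.univ := by rw [hd, withDensity_apply _ .univ, setLIntegral_univ]
      _ = 1 := measure_univ
  have : IsProbabilityMeasure ρ := ⟨hρ_univ⟩
  -- On a `ρ`-null set `h ∘ g` vanishes `ν`-a.e., whereas it is positive `μ`-a.e.
  have hacρ : μ ≪ ρ := by
    refine Measure.AbsolutelyContinuous.mk fun s hs h0 ↦ ?_
    rw [hρ, withDensity_apply _ hs, lintegral_eq_zero_iff hmg] at h0
    have h1 : ∀ᵐ a ∂μ, a ∈ s → (h ∘ g) a = 0 :=
      hac.ae_le ((ae_restrict_iff' hs).1 h0)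
    rw [← compl_compl s, ← mem_ae_iff]
    filter_upwards [h1, hr', hpos] with a h1 h2 h3 has
    rw [h2, h1 has] at h3
    exact lt_irrefl _ h3
  have hmul : μ.rnDeriv ρ * ρ.rnDeriv ν =ᵐ[μ] μ.rnDeriv ν :=
    hac.ae_le (Measure.rnDeriv_mul_rnDeriv hacρ)
  have hρν : ρ.rnDeriv ν =ᵐ[μ] h ∘ g := hac.ae_le (Measure.rnDeriv_withDensity ν hmg)
  -- The integral of the subtracted term is the relative entropy of the images, hence nonnegative.
  have hllr : llr μ ρ =ᵐ[μ] fun a ↦ llr μ ν a - llr (μ.map g) (ν.map g) (g a) := by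
    filter_upwards [hmul, hρν, hr', hpos, hlt, Measure.rnDeriv_pos hacρ,
      hacρ.ae_le (Measure.rnDeriv_lt_top μ ρ)] with a h1 h2 h3 h4 h5 h6 h7
    simp only [llr]
    rw [← h1, Pi.mul_apply, h2, ← h3, ENNReal.toReal_mul, Real.log_mul
      (ENNReal.toReal_pos h6.ne' h7.ne).ne' (ENNReal.toReal_pos h4.ne' h5.ne).ne']
    ring
  have hint_map := integrable_llr_map hac hg hint
  have hint_comp : Integrable (fun a ↦ llr (μ.map g) (ν.map g) (g a)) μ :=
    hint_map.comp_measurable hg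
  have hintρ : Integrable (llr μ ρ) μ := (integrable_congr hllr).2 (hint.sub hint_comp)
  rw [klDiv_of_ac_of_integrable hacρ hintρ, klDiv_of_ac_of_integrable hac hint]
  refine ENNReal.ofReal_le_ofReal ?_
  have hnn := integral_llr_add_sub_measure_univ_nonneg (hac.map hg) hint_map
  simp only [probReal_univ, add_sub_cancel_right] at hnn ⊢
  rw [integral_congr_ae hllr, integral_sub hint hint_comp]
  rw [integral_map hg.aemeasurable hint_map.aestronglyMeasurable] at hnn
  linarith

end InformationTheory

namespace NoisyFeedback

open InformationTheory

-- Rearranging composition products.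

section KernelLemmas

variable {α β γ : Type*} {mα : MeasurableSpace α} {mβ : MeasurableSpace β}
  {mγ : MeasurableSpace γ}

lemma klDiv_map_equiv (μ ν : Measure α) [IsFiniteMeasure μ] [IsFiniteMeasure ν] (e : α ≃ᵐ β) :
    klDiv (μ.map e) (ν.map e) = klDiv μ ν := by
  refine le_antisymm (klDiv_map_le μ ν e.measurable) ?_
  simpa using klDiv_map_le (μ.map e) (ν.map e) e.symm.measurable

/-- Used in the chain rule to disintegrate `P_A × P_{C,B}` as `(P_C × P_A) ⊗ P_{B|C}`. -/
lemma prod_compProd_map (ρ : Measure α) (σ : Measure γ) [SFinite ρ] [SFinite σ]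
    (κ : Kernel γ β) [IsSFiniteKernel κ] :
    (ρ.prod (σ ⊗ₘ κ)).map (fun p ↦ ((p.2.1, p.1), p.2.2)) = (σ.prod ρ) ⊗ₘ κ.prodMkRight α := by
  refine Measure.ext_of_lintegral _ fun f hf ↦ ?_
  rw [lintegral_map hf (by fun_prop), Measure.lintegral_compProd hf, lintegral_prod _ (by fun_prop),
    lintegral_prod_symm _ (Measurable.lintegral_kernel_prod_right' hf).aemeasurable]
  refine lintegral_congr fun a ↦ ?_
  rw [Measure.lintegral_compProd (by fun_prop)]
  simp [Kernel.prodMkRight_apply]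

lemma compProd_map_left (μ : Measure α) [SFinite μ] {f : α → γ} (hf : Measurable f)
    (κ : Kernel γ β) [IsSFiniteKernel κ] :
    (μ.map f) ⊗ₘ κ = (μ ⊗ₘ κ.comap f hf).map (Prod.map f id) := by
  ext s hs
  rw [Measure.map_apply (by fun_prop) hs, Measure.compProd_apply hs,
    Measure.compProd_apply (hs.preimage (by fun_prop)),
    lintegral_map (Kernel.measurable_kernel_prodMk_left hs) hf]
  rfl

end KernelLemmas

-- Conditional laws and sufficient statistics.

section CondDistrib

variable {Ω α β γ ζ : Type*} [MeasurableSpace Ω] [MeasurableSpace α] [MeasurableSpace β]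
  [MeasurableSpace γ] [MeasurableSpace ζ] {P : Measure Ω}

lemma hasCondDistrib_condDistrib [StandardBorelSpace β] [Nonempty β] [IsFiniteMeasure P]
    {B : Ω → β} {C : Ω → γ} (hB : Measurable B) (hC : Measurable C) :
    HasCondDistrib B C (condDistrib B C P) P :=
  ⟨by fun_prop, (compProd_map_condDistrib hB.aemeasurable).symm⟩

/-- If the conditional law of `B` given `Z` depends on `Z` only through a statistic `W` of `Z`,
then it is the conditional law of `B` given `W`. -/
lemma _root_.ProbabilityTheory.HasCondDistrib.of_statistic [IsFiniteMeasure P] {B : Ω → β}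
    {Z : Ω → ζ} {W : Ω → γ}
    {κ : Kernel ζ β} [IsMarkovKernel κ] {η : Kernel γ β} [IsMarkovKernel η]
    (h : HasCondDistrib B Z κ P) {f : ζ → γ} (hf : Measurable f)
    (hW : ∀ᵐ ω ∂P, W ω = f (Z ω)) (hη : ∀ᵐ ω ∂P, η (W ω) = κ (Z ω)) :
    HasCondDistrib B W η P := by
  have hZ : AEMeasurable Z P := h.aemeasurable_fst
  have hB : AEMeasurable B P := h.aemeasurable_snd
  have hfZ : AEMeasurable (fun ω ↦ f (Z ω)) P := hf.comp_aemeasurable hZ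
  have hWm : AEMeasurable W P := hfZ.congr (hW.mono fun ω hω ↦ hω.symm)
  refine ⟨hWm.prodMk hB, ?_⟩
  have h1 : P.map (fun ω ↦ (W ω, B ω)) = (P.map fun ω ↦ (Z ω, B ω)).map (Prod.map f id) := by
    rw [AEMeasurable.map_map_of_aemeasurable (by fun_prop) (by fun_prop)]
    exact Measure.map_congr (hW.mono fun ω hω ↦ by simp [hω])
  rw [h1, h.map_eq]
  ext s hs
  rw [Measure.map_apply (by fun_prop) hs, Measure.compProd_apply hs,
    Measure.compProd_apply (hs.preimage (by fun_prop)),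
    lintegral_map' (Kernel.measurable_kernel_prodMk_left hs).aemeasurable hWm,
    lintegral_map' (Kernel.measurable_kernel_prodMk_left
      (hs.preimage (by fun_prop))).aemeasurable hZ]
  refine lintegral_congr_ae ?_
  filter_upwards [hW, hη] with ω h1 h2
  rw [h2, h1]
  rfl

end CondDistrib

-- Mutual information: data processing and the chain rule.

section Information

variable {Ω α β γ ζ α' γ' : Type*} [MeasurableSpace Ω] [MeasurableSpace α] [MeasurableSpace β]
  [MeasurableSpace γ] [MeasurableSpace ζ] [MeasurableSpace α'] [MeasurableSpace γ']
  {P : Measure Ω} [IsProbabilityMeasure P]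

/-- Data processing for mutual information. -/
lemma mutualInfo_le_of_ae_eq {β' : Type*} [MeasurableSpace β'] {A : Ω → α} {B : Ω → β}
    {B' : Ω → β'} (hA : Measurable A) (hB : Measurable B) {f : β → β'} (hf : Measurable f)
    (h : ∀ᵐ ω ∂P, B' ω = f (B ω)) : mutualInfo A B' P ≤ mutualInfo A B P := by
  refine ENNReal.div_le_div_right ?_ _
  have : IsProbabilityMeasure (P.map A) := Measure.isProbabilityMeasure_map hA.aemeasurable
  have : IsProbabilityMeasure (P.map B) := Measure.isProbabilityMeasure_map hB.aemeasurable
  have h1 : P.map (fun ω ↦ (A ω, B' ω)) = (P.map fun ω ↦ (A ω, B ω)).map (Prod.map id f) := by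
    rw [Measure.map_map (by fun_prop) (by fun_prop)]
    exact Measure.map_congr (h.mono fun ω hω ↦ by simp [hω])
  have h2 : P.map B' = (P.map B).map f := by
    rw [Measure.map_map (by fun_prop) (by fun_prop)]
    exact Measure.map_congr h
  have h3 : (P.map A).prod (P.map B') = ((P.map A).prod (P.map B)).map (Prod.map id f) := by
    rw [h2, ← Measure.map_prod_map _ _ measurable_id hf, Measure.map_id]
  rw [h1, h3]
  exact klDiv_map_le _ _ (by fun_prop)

lemma mutualInfo_eq_zero_of_indepFun {A : Ω → α} {B : Ω → β} (hA : Measurable A)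
    (hB : Measurable B) (h : IndepFun A B P) : mutualInfo A B P = 0 := by
  have : IsProbabilityMeasure (P.map A) := Measure.isProbabilityMeasure_map hA.aemeasurable
  have : IsProbabilityMeasure (P.map B) := Measure.isProbabilityMeasure_map hB.aemeasurable
  rw [mutualInfo, (indepFun_iff_map_prod_eq_prod_map_map hA.aemeasurable hB.aemeasurable).1 h,
    klDiv_self, ENNReal.zero_div]

variable [StandardBorelSpace β] [Nonempty β]

/-- Any version `κ` of the law of `B` given `(C, A)` is allowed, so that the channel kernel itself
can be inserted later. -/
lemma condMutualInfo_eq_lintegral {A : Ω → α} {B : Ω → β} {C : Ω → γ} (hA : Measurable A)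
    (hC : Measurable C) {κ : Kernel (γ × α) β} [IsMarkovKernel κ]
    (h : HasCondDistrib B (fun ω ↦ (C ω, A ω)) κ P) :
    condMutualInfo A B C P =
      (∫⁻ ω, klDiv (κ (C ω, A ω)) (condDistrib B C P (C ω)) ∂P) / ENNReal.ofReal (Real.log 2) := by
  rw [condMutualInfo, h.map_eq, klDiv_compProd_right_eq_lintegral,
    lintegral_map (measurable_klDiv_kernel _ _) (by fun_prop)]
  simp [Kernel.prodMkRight_apply]

lemma condMutualInfo_eq_lintegral_condDistrib {A : Ω → α} {B : Ω → β} {C : Ω → γ}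
    (hA : Measurable A) (hB : Measurable B) (hC : Measurable C) :
    condMutualInfo A B C P =
      (∫⁻ ω, klDiv (condDistrib B (fun ω ↦ (C ω, A ω)) P (C ω, A ω)) (condDistrib B C P (C ω)) ∂P)
        / ENNReal.ofReal (Real.log 2) :=
  condMutualInfo_eq_lintegral hA hC (hasCondDistrib_condDistrib hB (by fun_prop))

/-- The law given `C`, pulled back along `g`, is a conditional law given `C'`, and conditional laws
are a.e. unique. -/
lemma condDistrib_ae_eq_of_ae_eq {B : Ω → β} {C : Ω → γ} {C' : Ω → γ'} (hB : Measurable B)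
    (hC : Measurable C) (hC' : Measurable C') {f : γ → γ'} {g : γ' → γ} (hf : Measurable f)
    (hg : Measurable g) (hfC : ∀ᵐ ω ∂P, C' ω = f (C ω)) (hgC : ∀ᵐ ω ∂P, C ω = g (C' ω)) :
    ∀ᵐ ω ∂P, condDistrib B C' P (C' ω) = condDistrib B C P (C ω) := by
  have h : HasCondDistrib B C' ((condDistrib B C P).comap g hg) P :=
    (hasCondDistrib_condDistrib hB hC).of_statistic hf hfC
      (hgC.mono fun ω hω ↦ by rw [Kernel.comap_apply, ← hω])
  filter_upwards [ae_of_ae_map hC'.aemeasurable (condDistrib_ae_eq_of_measure_eq_compProd C'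
    hB.aemeasurable h.map_eq), hgC] with ω h1 h2
  rw [h1, Kernel.comap_apply, ← h2]

/-- Conditional mutual information depends on the conditioning variable only through the
information that it carries. -/
lemma condMutualInfo_congr_cond {A : Ω → α} {B : Ω → β} {C : Ω → γ} {C' : Ω → γ'}
    (hA : Measurable A) (hB : Measurable B) (hC : Measurable C) (hC' : Measurable C')
    {f : γ → γ'} {g : γ' → γ} (hf : Measurable f) (hg : Measurable g)
    (hfC : ∀ᵐ ω ∂P, C' ω = f (C ω)) (hgC : ∀ᵐ ω ∂P, C ω = g (C' ω)) :
    condMutualInfo A B C' P = condMutualInfo A B C P := by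
  rw [condMutualInfo_eq_lintegral_condDistrib hA hB hC',
    condMutualInfo_eq_lintegral_condDistrib hA hB hC]
  congr 1
  refine lintegral_congr_ae ?_
  filter_upwards [condDistrib_ae_eq_of_ae_eq hB hC hC' hf hg hfC hgC,
    condDistrib_ae_eq_of_ae_eq (f := Prod.map f id) (g := Prod.map g id) hB (hC.prodMk hA)
      (hC'.prodMk hA) (by fun_prop) (by fun_prop) (hfC.mono fun ω hω ↦ by simp [hω])
      (hgC.mono fun ω hω ↦ by simp [← hω])] with ω h1 h2
  rw [h1, h2]

/-- Data processing for conditional mutual information. -/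
lemma condMutualInfo_le_of_eq_comp {A : Ω → α} {A' : Ω → α'} {B : Ω → β} {C : Ω → γ}
    (hA : Measurable A) (hB : Measurable B) (hC : Measurable C) {f : α → α'} (hf : Measurable f)
    (h : ∀ ω, A' ω = f (A ω)) : condMutualInfo A' B C P ≤ condMutualInfo A B C P := by
  obtain rfl : A' = fun ω ↦ f (A ω) := funext h
  refine ENNReal.div_le_div_right ?_ _
  have h1 : P.map (fun ω ↦ ((C ω, f (A ω)), B ω))
      = (P.map fun ω ↦ ((C ω, A ω), B ω)).map (Prod.map (Prod.map id f) id) := by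
    rw [Measure.map_map (by fun_prop) (by fun_prop)]
    rfl
  have h2 : P.map (fun ω ↦ (C ω, f (A ω))) = (P.map fun ω ↦ (C ω, A ω)).map (Prod.map id f) := by
    rw [Measure.map_map (by fun_prop) (by fun_prop)]
    rfl
  rw [h1, h2, compProd_map_left _ (by fun_prop)]
  exact klDiv_map_le _ _ (by fun_prop)

/-- Among the kernels that only see `C`, the conditional law of `B` given `C` is the closest one
to the joint law. -/
lemma lintegral_klDiv_condDistrib_le {A : Ω → α} {B : Ω → β} {C : Ω → γ}
    (hA : Measurable A) (hB : Measurable B) (hC : Measurable C) {κ : Kernel (γ × α) β}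
    [IsMarkovKernel κ] (h : HasCondDistrib B (fun ω ↦ (C ω, A ω)) κ P) (η : Kernel γ β)
    [IsMarkovKernel η] :
    ∫⁻ ω, klDiv (κ (C ω, A ω)) (condDistrib B C P (C ω)) ∂P
      ≤ ∫⁻ ω, klDiv (κ (C ω, A ω)) (η (C ω)) ∂P := by
  have hCA : Measurable fun ω ↦ (C ω, A ω) := hC.prodMk hA
  have : IsProbabilityMeasure (P.map C) := Measure.isProbabilityMeasure_map hC.aemeasurable
  have : IsProbabilityMeasure (P.map fun ω ↦ (C ω, A ω)) :=
    Measure.isProbabilityMeasure_map hCA.aemeasurable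
  have key (ξ : Kernel γ β) [IsMarkovKernel ξ] :
      ∫⁻ ω, klDiv (κ (C ω, A ω)) (ξ (C ω)) ∂P
        = klDiv (P.map (fun ω ↦ (C ω, A ω)) ⊗ₘ κ)
            (P.map (fun ω ↦ (C ω, A ω)) ⊗ₘ ξ.prodMkRight α) := by
    rw [klDiv_compProd_right_eq_lintegral, lintegral_map (measurable_klDiv_kernel _ _) hCA]
    simp [Kernel.prodMkRight_apply]
  rw [key, key]
  set μ := P.map (fun ω ↦ (C ω, A ω)) ⊗ₘ κ with hμ
  set ν := P.map (fun ω ↦ (C ω, A ω)) ⊗ₘ η.prodMkRight α with hν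
  by_cases htop : klDiv μ ν = ∞
  · simp [htop]
  have hac : μ ≪ ν := (klDiv_ne_top_iff.1 htop).1
  have hg : Measurable (fun p : (γ × α) × β ↦ (p.1.1, p.2)) := by fun_prop
  have hμg : μ.map (fun p ↦ (p.1.1, p.2)) = P.map C ⊗ₘ condDistrib B C P := by
    rw [hμ, ← h.map_eq, Measure.map_map hg (by fun_prop), compProd_map_condDistrib hB.aemeasurable]
    rfl
  have hνg : ν.map (fun p ↦ (p.1.1, p.2)) = P.map C ⊗ₘ η := by
    have : P.map C = (P.map fun ω ↦ (C ω, A ω)).map Prod.fst := by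
      rw [Measure.map_map (by fun_prop) (by fun_prop)]
      rfl
    rw [this, compProd_map_left _ measurable_fst]
    rfl
  have hacC : ∀ᵐ c ∂(P.map C), condDistrib B C P c ≪ η c := by
    refine Measure.AbsolutelyContinuous.kernel_of_compProd (ν := P.map C) ?_
    rw [← hμg, ← hνg]
    exact hac.map hg
  have hm : Measurable (Function.uncurry ((condDistrib B C P).rnDeriv η)) :=
    Kernel.measurable_rnDeriv _ _
  have hd : μ.map (fun p ↦ (p.1.1, p.2)) = (ν.map fun p ↦ (p.1.1, p.2)).withDensity
      (Function.uncurry ((condDistrib B C P).rnDeriv η)) := by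
    rw [hμg, hνg]
    refine Eq.trans (Measure.compProd_congr ?_) (Measure.compProd_withDensity hm)
    filter_upwards [hacC] with c hc using (Kernel.withDensity_rnDeriv_eq hc).symm
  -- Here `g` forgets `A`, so the correction turns `η` into the law of `B` given `C`.
  have hle := klDiv_withDensity_le μ ν hg hm hd
  have hνρ : ν.withDensity (Function.uncurry ((condDistrib B C P).rnDeriv η) ∘
      fun p ↦ (p.1.1, p.2))
      = P.map (fun ω ↦ (C ω, A ω)) ⊗ₘ (condDistrib B C P).prodMkRight α := by
    refine Measure.ext_of_lintegral _ fun f hf ↦ ?_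
    rw [lintegral_withDensity_eq_lintegral_mul _ (hm.comp hg) hf, hν,
      Measure.lintegral_compProd (by fun_prop), Measure.lintegral_compProd hf,
      lintegral_map (by fun_prop) hCA, lintegral_map (by fun_prop) hCA]
    refine lintegral_congr_ae ?_
    filter_upwards [ae_of_ae_map hC.aemeasurable hacC] with ω hω
    simp only [Kernel.prodMkRight_apply, Pi.mul_apply, Function.comp_apply, Function.uncurry]
    conv_rhs => rw [← Kernel.withDensity_rnDeriv_eq hω, Kernel.withDensity_apply _ hm]
    rw [lintegral_withDensity_eq_lintegral_mul _ (by fun_prop) (by fun_prop)]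
    rfl
  rwa [hνρ] at hle

/-- Moving a part of the first argument into the condition does not increase the conditional
mutual information. -/
lemma condMutualInfo_prodMk_cond_le {δ : Type*} [MeasurableSpace δ] {A : Ω → α} {B : Ω → β}
    {C : Ω → γ} {D : Ω → δ} (hA : Measurable A) (hB : Measurable B) (hC : Measurable C)
    (hD : Measurable D) :
    condMutualInfo A B (fun ω ↦ (C ω, D ω)) P ≤ condMutualInfo (fun ω ↦ (A ω, D ω)) B C P := by
  have h := hasCondDistrib_condDistrib (P := P) hB ((hC.prodMk hD).prodMk hA)
  have h' : HasCondDistrib B (fun ω ↦ (C ω, (A ω, D ω)))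
      ((condDistrib B (fun ω ↦ ((C ω, D ω), A ω)) P).comap
        (fun p : γ × α × δ ↦ ((p.1, p.2.2), p.2.1)) (by fun_prop)) P :=
    h.of_statistic (f := fun p ↦ (p.1.1, p.2, p.1.2)) (by fun_prop) (by simp)
      (by simp [Kernel.comap_apply])
  rw [condMutualInfo_eq_lintegral hA (hC.prodMk hD) h,
    condMutualInfo_eq_lintegral (hA.prodMk hD) hC h']
  -- The competitor is the law of `B` given `C` alone, seen as a kernel that ignores `D`. It yields
  -- the right-hand side exactly.
  exact ENNReal.div_le_div_right (lintegral_klDiv_condDistrib_le hA hB (hC.prodMk hD) h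
    ((condDistrib B C P).comap Prod.fst measurable_fst)) _

/-- The chain rule for mutual information. -/
lemma mutualInfo_prodMk {A : Ω → α} {B : Ω → β} {C : Ω → γ} (hA : Measurable A)
    (hB : Measurable B) (hC : Measurable C) :
    mutualInfo A (fun ω ↦ (C ω, B ω)) P = mutualInfo A C P + condMutualInfo A B C P := by
  have : IsProbabilityMeasure (P.map A) := Measure.isProbabilityMeasure_map hA.aemeasurable
  have : IsProbabilityMeasure (P.map C) := Measure.isProbabilityMeasure_map hC.aemeasurable
  have hCA : Measurable fun ω ↦ (C ω, A ω) := hC.prodMk hA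
  have : IsProbabilityMeasure (P.map fun ω ↦ (C ω, A ω)) :=
    Measure.isProbabilityMeasure_map hCA.aemeasurable
  let e : α × γ × β ≃ᵐ (γ × α) × β :=
    MeasurableEquiv.prodAssoc.symm.trans (MeasurableEquiv.prodComm.prodCongr (.refl β))
  have he : (e : α × γ × β → (γ × α) × β) = fun p ↦ ((p.2.1, p.1), p.2.2) := rfl
  have h1 : (P.map fun ω ↦ (A ω, C ω, B ω)).map e = P.map fun ω ↦ ((C ω, A ω), B ω) := by
    rw [Measure.map_map e.measurable (by fun_prop)]
    rfl
  have h2 : ((P.map A).prod (P.map fun ω ↦ (C ω, B ω))).map e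
      = ((P.map C).prod (P.map A)) ⊗ₘ (condDistrib B C P).prodMkRight α := by
    rw [← compProd_map_condDistrib hB.aemeasurable, he, prod_compProd_map]
  have h3 : klDiv (P.map fun ω ↦ (C ω, A ω)) ((P.map C).prod (P.map A))
      = klDiv (P.map fun ω ↦ (A ω, C ω)) ((P.map A).prod (P.map C)) := by
    rw [← klDiv_map_equiv _ _ MeasurableEquiv.prodComm,
      Measure.map_map MeasurableEquiv.prodComm.measurable (by fun_prop)]
    congr 1
    exact Measure.prod_swap
  have : IsProbabilityMeasure (P.map fun ω ↦ (C ω, B ω)) :=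
    Measure.isProbabilityMeasure_map (by fun_prop)
  have : IsProbabilityMeasure (P.map fun ω ↦ (A ω, C ω, B ω)) :=
    Measure.isProbabilityMeasure_map (by fun_prop)
  -- Both laws of `((C, A), B)` are now disintegrated over `(C, A)`, and relative entropy splits
  -- into a base part and a kernel part.
  rw [mutualInfo, mutualInfo, condMutualInfo, ← ENNReal.add_div, ← klDiv_map_equiv _ _ e, h1, h2,
    ← compProd_map_condDistrib hB.aemeasurable, klDiv_compProd_eq_add, h3]

end Information

-- Chain rules for sequences.

section Sequences

variable {Ω α 𝒳 𝒴 γ : Type*} [MeasurableSpace Ω] [MeasurableSpace α] [MeasurableSpace 𝒳]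
  [MeasurableSpace 𝒴] [MeasurableSpace γ]

@[fun_prop]
lemma measurable_block {n : ℕ} {Y : Fin n → Ω → 𝒴} (hY : ∀ i, Measurable (Y i)) :
    Measurable (block Y) := measurable_pi_lambda _ hY

@[fun_prop]
lemma measurable_before {n : ℕ} {Y : Fin n → Ω → 𝒴} (hY : ∀ i, Measurable (Y i)) (i : Fin n) :
    Measurable (before Y i) := measurable_pi_lambda _ fun j ↦ hY j

@[fun_prop]
lemma measurable_upTo {n : ℕ} {X : Fin n → Ω → 𝒳} (hX : ∀ i, Measurable (X i)) (i : Fin n) :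
    Measurable (upTo X i) := measurable_pi_lambda _ fun j ↦ hX j

variable {P : Measure Ω} [IsProbabilityMeasure P] [StandardBorelSpace 𝒴] [Nonempty 𝒴]

/-- The chain rule for the mutual information with a sequence. -/
lemma mutualInfo_block_prodMk {A : Ω → α} {C : Ω → γ} (hA : Measurable A) (hC : Measurable C)
    {n : ℕ} {Y : Fin n → Ω → 𝒴} (hY : ∀ i, Measurable (Y i)) :
    mutualInfo A (fun ω ↦ (block Y ω, C ω)) P
      = mutualInfo A C P + ∑ i, condMutualInfo A (Y i) (fun ω ↦ (before Y i ω, C ω)) P := by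
  induction n with
  | zero =>
    simp only [Finset.univ_eq_empty, Finset.sum_empty, add_zero]
    have hb := measurable_block hY
    refine le_antisymm (mutualInfo_le_of_ae_eq hA hC (f := fun c ↦ (Fin.elim0, c)) (by fun_prop)
      (ae_of_all _ fun ω ↦ Prod.ext (Subsingleton.elim _ _) rfl)) ?_
    exact mutualInfo_le_of_ae_eq hA (by fun_prop) measurable_snd (by simp)
  | succ n ih =>
    have hY' (i : Fin n) : Measurable (Y i.castSucc) := hY _
    have hb := measurable_block hY
    have hb' := measurable_block hY'
    have hl := hY (Fin.last n)
    have h1 : mutualInfo A (fun ω ↦ (block Y ω, C ω)) P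
        = mutualInfo A (fun ω ↦ ((block (fun i : Fin n ↦ Y i.castSucc) ω, C ω), Y (Fin.last n) ω))
            P := by
      refine le_antisymm (mutualInfo_le_of_ae_eq hA (by fun_prop)
        (f := fun p ↦ (Fin.snoc (α := fun _ ↦ 𝒴) p.1.1 p.2, p.1.2)) ?_ (ae_of_all _ fun ω ↦ ?_))
        (mutualInfo_le_of_ae_eq hA (by fun_prop)
        (f := fun p ↦ ((fun i ↦ p.1 i.castSucc, p.2), p.1 (Fin.last n))) (by fun_prop)
        (ae_of_all _ fun ω ↦ rfl))
      · refine Measurable.prodMk (measurable_pi_lambda _ fun i ↦ ?_) (by fun_prop)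
        cases i using Fin.lastCases with
        | last => simp only [Fin.snoc_last]; fun_prop
        | cast i => simp only [Fin.snoc_castSucc]; fun_prop
      · refine Prod.ext (funext fun i ↦ ?_) rfl
        cases i using Fin.lastCases with
        | last => simp [block]
        | cast i => simp [block]
    rw [h1, mutualInfo_prodMk hA hl (by fun_prop), ih hY', Fin.sum_univ_castSucc, ← add_assoc]
    congr 1
    · congr 1
      refine Finset.sum_congr rfl fun i _ ↦ ?_
      have h2 := measurable_before hY' i
      have h3 := measurable_before hY i.castSucc
      -- The two pasts are indexed by initial segments of `Fin n` and of `Fin (n + 1)`, so `f` and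
      -- `g` only reindex.
      refine condMutualInfo_congr_cond hA (hY' i) (by fun_prop) (by fun_prop)
        (f := fun p ↦ (fun j ↦ p.1 ⟨(j : Fin n).castSucc, Fin.castSucc_lt_castSucc_iff.2 j.2⟩, p.2))
        (g := fun p ↦ (fun j ↦ p.1 ⟨(j : Fin (n + 1)).castPred (ne_of_lt
          (lt_trans j.2 (Fin.castSucc_lt_last i))), j.2⟩, p.2)) (by fun_prop) (by fun_prop)
        (ae_of_all _ fun ω ↦ rfl) (ae_of_all _ fun ω ↦ rfl)
    · have h3 := measurable_before hY (Fin.last n)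
      refine condMutualInfo_congr_cond hA hl (by fun_prop) (by fun_prop)
        (f := fun p ↦ (fun j ↦ p.1 ⟨(j : Fin n).castSucc, Fin.castSucc_lt_last _⟩, p.2))
        (g := fun p ↦ (fun j ↦ p.1 ((j : Fin (n + 1)).castPred (ne_of_lt j.2)), p.2))
        (by fun_prop) (by fun_prop) (ae_of_all _ fun ω ↦ rfl) (ae_of_all _ fun ω ↦ rfl)

lemma mutualInfo_block {A : Ω → α} (hA : Measurable A) {n : ℕ} {Y : Fin n → Ω → 𝒴}
    (hY : ∀ i, Measurable (Y i)) :
    mutualInfo A (block Y) P = ∑ i, condMutualInfo A (Y i) (before Y i) P := by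
  have hb := measurable_block hY
  -- A constant side variable removes the conditioning.
  have h := mutualInfo_block_prodMk (P := P) hA (measurable_const (a := ())) hY
  rw [mutualInfo_eq_zero_of_indepFun hA measurable_const (indepFun_const_right A ()), zero_add] at h
  have h1 : mutualInfo A (block Y) P = mutualInfo A (fun ω ↦ (block Y ω, ())) P :=
    le_antisymm (mutualInfo_le_of_ae_eq hA (by fun_prop) measurable_fst (by simp))
      (mutualInfo_le_of_ae_eq hA hb (f := fun y ↦ (y, ())) (by fun_prop) (by simp))
  rw [h1, h]
  refine Finset.sum_congr rfl fun i _ ↦ ?_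
  have hi := measurable_before hY i
  exact condMutualInfo_congr_cond hA (hY i) hi (by fun_prop) (f := fun y ↦ (y, ())) (g := Prod.fst)
    (by fun_prop) measurable_fst (by simp) (by simp)

end Sequences

-- Inserting the channel law.

namespace IsFeedbackChannel

variable {Ω 𝓜 𝒳 𝒴 : Type*} [MeasurableSpace Ω] [MeasurableSpace 𝓜] [MeasurableSpace 𝒳]
  [MeasurableSpace 𝒴] [StandardBorelSpace 𝒴] [AddCommGroup 𝒴]
  {P : Measure Ω} [IsProbabilityMeasure P] {n : ℕ}
  {κ : ∀ i : Fin n, Kernel ((Set.Iic i → 𝒳) × (Set.Iio i → 𝒴)) 𝒴} [∀ i, IsMarkovKernel (κ i)]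
  {enc : ∀ i : Fin n, 𝓜 × (Set.Iio i → 𝒴) → 𝒳}
  {M : Ω → 𝓜} {X : Fin n → Ω → 𝒳} {Y V : Fin n → Ω → 𝒴}

/-- If the pair of `C` and `A` is a function of the message, the feedback noise, the inputs and the
previous outputs that determines the channel inputs and the previous outputs, then the output law
given `C` and `A` is that of the channel. -/
lemma condMutualInfo_eq {α γ : Type*} [MeasurableSpace α] [MeasurableSpace γ]
    (h : IsFeedbackChannel κ enc M X Y V P) (i : Fin n) {A : Ω → α} {C : Ω → γ}
    (hA : Measurable A) (hC : Measurable C)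
    {f : (𝓜 × (Fin n → 𝒴)) × (Set.Iic i → 𝒳) × (Set.Iio i → 𝒴) → γ × α} (hf : Measurable f)
    {g : γ × α → (Set.Iic i → 𝒳) × (Set.Iio i → 𝒴)} (hg : Measurable g)
    (hfA : ∀ᵐ ω ∂P, (C ω, A ω) = f ((M ω, block V ω), (upTo X i ω, before Y i ω)))
    (hgA : ∀ᵐ ω ∂P, (upTo X i ω, before Y i ω) = g (C ω, A ω)) :
    condMutualInfo A (Y i) C P =
      (∫⁻ ω, klDiv (κ i (upTo X i ω, before Y i ω)) (condDistrib (Y i) C P (C ω)) ∂P)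
        / ENNReal.ofReal (Real.log 2) := by
  have h1 : HasCondDistrib (Y i) (fun ω ↦ (C ω, A ω)) ((κ i).comap g hg) P :=
    (h.output_law i).of_statistic hf hfA
      (hgA.mono fun ω hω ↦ by rw [Kernel.comap_apply, Kernel.prodMkLeft_apply, hω])
  rw [condMutualInfo_eq_lintegral hA hC h1]
  congr 1
  refine lintegral_congr_ae (hgA.mono fun ω hω ↦ ?_)
  simp only [Kernel.comap_apply]
  rw [← hω]

lemma condMutualInfo_upTo_cond (h : IsFeedbackChannel κ enc M X Y V P) (i : Fin n) :
    condMutualInfo (upTo X i) (Y i) (fun ω ↦ (before Y i ω, block V ω)) P =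
      (∫⁻ ω, klDiv (κ i (upTo X i ω, before Y i ω))
        (condDistrib (Y i) (fun ω ↦ (before Y i ω, block V ω)) P (before Y i ω, block V ω)) ∂P)
        / ENNReal.ofReal (Real.log 2) := by
  have hX := measurable_upTo h.measurable_input i
  have hY := measurable_before h.measurable_output i
  have hV := measurable_block h.measurable_noise
  exact h.condMutualInfo_eq i hX (hY.prodMk hV) (f := fun p ↦ ((p.2.2, p.1.2), p.2.1))
    (by fun_prop) (g := fun p ↦ (p.2, p.1.1)) (by fun_prop) (by simp) (by simp)

lemma condMutualInfo_upTo (h : IsFeedbackChannel κ enc M X Y V P) (i : Fin n) :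
    condMutualInfo (upTo X i) (Y i) (before Y i) P =
      (∫⁻ ω, klDiv (κ i (upTo X i ω, before Y i ω))
        (condDistrib (Y i) (before Y i) P (before Y i ω)) ∂P) / ENNReal.ofReal (Real.log 2) := by
  have hX := measurable_upTo h.measurable_input i
  have hY := measurable_before h.measurable_output i
  exact h.condMutualInfo_eq i hX hY (f := fun p ↦ (p.2.2, p.2.1))
    (by fun_prop) (g := fun p ↦ (p.2, p.1)) (by fun_prop) (by simp) (by simp)

/-- Given the previous outputs and the feedback noise, the message acts on an output exactly
through the channel inputs. -/
lemma condMutualInfo_message [MeasurableAdd₂ 𝒴] (h : IsFeedbackChannel κ enc M X Y V P)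
    (i : Fin n) :
    condMutualInfo M (Y i) (fun ω ↦ (before Y i ω, block V ω)) P =
      condMutualInfo (upTo X i) (Y i) (fun ω ↦ (before Y i ω, block V ω)) P := by
  have hY := measurable_before h.measurable_output i
  have hV := measurable_block h.measurable_noise
  have henc := h.measurable_enc
  rw [h.condMutualInfo_upTo_cond]
  refine h.condMutualInfo_eq i h.measurable_message (hY.prodMk hV)
    (f := fun p ↦ ((p.2.2, p.1.2), p.1.1)) (by fun_prop)
    -- The encoder at time `j ≤ i` needs only the feedback at times `k < j`, hence outputs strictly
    -- before `i`.
    (g := fun p ↦ (fun j ↦ enc j (p.2, fun k ↦ p.1.1 ⟨k, lt_of_lt_of_le (Set.mem_Iio.1 k.2) j.2⟩ + p.1.2 k),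
      p.1.1)) ?_ (by simp) ?_
  · refine Measurable.prodMk (measurable_pi_lambda _ fun j ↦ (henc j).comp ?_) (by fun_prop)
    fun_prop
  · filter_upwards [ae_all_iff.2 h.input_eq] with ω hω
    exact Prod.ext (funext fun j ↦ hω j) rfl

end IsFeedbackChannel

end NoisyFeedback

-- The chain of inequalities and its equality cases.

theorem lemma2 {Ω 𝓜 𝒳 𝒴 : Type*} [MeasurableSpace Ω] [MeasurableSpace 𝓜] [MeasurableSpace 𝒳]
    [MeasurableSpace 𝒴] [StandardBorelSpace 𝒴] [AddCommGroup 𝒴] [MeasurableAdd₂ 𝒴]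
    (P : Measure Ω) [IsProbabilityMeasure P] (n : ℕ)
    (κ : ∀ i : Fin n, Kernel ((Set.Iic i → 𝒳) × (Set.Iio i → 𝒴)) 𝒴) [∀ i, IsMarkovKernel (κ i)]
    (enc : ∀ i : Fin n, 𝓜 × (Set.Iio i → 𝒴) → 𝒳)
    (M : Ω → 𝓜) (X : Fin n → Ω → 𝒳) (Y V : Fin n → Ω → 𝒴)
    (h : NoisyFeedback.IsFeedbackChannel κ enc M X Y V P) :
    (NoisyFeedback.mutualInfo M (NoisyFeedback.block Y) P
        ≤ NoisyFeedback.condDirectedInfo X Y (NoisyFeedback.block V) P ∧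
      NoisyFeedback.condDirectedInfo X Y (NoisyFeedback.block V) P
        ≤ NoisyFeedback.directedInfo X Y P ∧
      NoisyFeedback.directedInfo X Y P
        ≤ NoisyFeedback.mutualInfo (NoisyFeedback.block X) (NoisyFeedback.block Y) P) ∧
    ((∀ i, ∀ᵐ ω ∂P, V i ω = 0) →
      NoisyFeedback.mutualInfo M (NoisyFeedback.block Y) P
        = NoisyFeedback.condDirectedInfo X Y (NoisyFeedback.block V) P ∧
      NoisyFeedback.condDirectedInfo X Y (NoisyFeedback.block V) P
        = NoisyFeedback.directedInfo X Y P) ∧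
    (NoisyFeedback.WithoutFeedback M X P →
      NoisyFeedback.directedInfo X Y P
        = NoisyFeedback.mutualInfo (NoisyFeedback.block X) (NoisyFeedback.block Y) P) := by
  open NoisyFeedback in
  have hM := h.measurable_message
  have hXi := h.measurable_input
  have hYi := h.measurable_output
  have hX := measurable_block hXi
  have hY := measurable_block hYi
  have hV := measurable_block h.measurable_noise
  have hchain : mutualInfo M (fun ω ↦ (block Y ω, block V ω)) P
      = condDirectedInfo X Y (block V) P := by
    rw [mutualInfo_block_prodMk hM hV hYi,
      mutualInfo_eq_zero_of_indepFun hM hV h.message_indep_noise, zero_add]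
    exact Finset.sum_congr rfl fun i _ ↦ h.condMutualInfo_message i
  have hfst : mutualInfo M (block Y) P ≤ condDirectedInfo X Y (block V) P := by
    rw [← hchain]
    exact mutualInfo_le_of_ae_eq hM (by fun_prop) measurable_fst (by simp)
  have hV0 (h0 : ∀ i, ∀ᵐ ω ∂P, V i ω = 0) : ∀ᵐ ω ∂P, block V ω = 0 := by
    filter_upwards [ae_all_iff.2 h0] with ω hω using funext hω
  refine ⟨⟨hfst, ?_, ?_⟩, fun h0 ↦ ⟨hfst.antisymm ?_, ?_⟩, ?_⟩
  · refine Finset.sum_le_sum fun i _ ↦ ?_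
    have hXu := measurable_upTo hXi i
    have hYb := measurable_before hYi i
    -- Once `Vⁿ` has joined `Xⁱ`, it adds nothing: the output law depends only on `(Xⁱ, Yⁱ⁻¹)`.
    refine (condMutualInfo_prodMk_cond_le hXu (hYi i) hYb hV).trans_eq ?_
    rw [h.condMutualInfo_upTo]
    exact h.condMutualInfo_eq i (hXu.prodMk hV) hYb (f := fun p ↦ (p.2.2, p.2.1, p.1.2))
      (by fun_prop) (g := fun p ↦ (p.2.1, p.1)) (by fun_prop) (by simp) (by simp)
  · rw [mutualInfo_block hX hYi]
    refine Finset.sum_le_sum fun i _ ↦ ?_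
    exact condMutualInfo_le_of_eq_comp hX (hYi i) (measurable_before hYi i)
      (f := fun x j ↦ x j) (by fun_prop) fun ω ↦ rfl
  -- When the noise vanishes, `(Yⁿ, Vⁿ)` is a.s. a function of `Yⁿ`.
  · rw [← hchain]
    exact mutualInfo_le_of_ae_eq hM hY (f := fun y ↦ (y, 0)) (by fun_prop)
      ((hV0 h0).mono fun ω hω ↦ by rw [hω])
  · refine Finset.sum_congr rfl fun i _ ↦ ?_
    have hYb := measurable_before hYi i
    exact condMutualInfo_congr_cond (measurable_upTo hXi i) (hYi i) hYb (hYb.prodMk hV)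
      (f := fun y ↦ (y, 0)) (by fun_prop) measurable_fst ((hV0 h0).mono fun ω hω ↦ by rw [hω])
      (by simp)
  · rintro ⟨e, he, hXe⟩
    rw [mutualInfo_block hX hYi]
    refine Finset.sum_congr rfl fun i _ ↦ ?_
    -- Later inputs are functions of `M` here, so conditioning on all of `Xⁿ` leaves the output law
    -- that of the channel. With feedback they could depend on `Yᵢ`.
    rw [h.condMutualInfo_upTo, h.condMutualInfo_eq i hX (measurable_before hYi i)
      (f := fun p ↦ (p.2.2, fun j ↦ e j p.1.1)) (by fun_prop)
      (g := fun p ↦ (fun j ↦ p.2 j, p.1)) (by fun_prop) ?_ (ae_of_all _ fun ω ↦ rfl)]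
    filter_upwards [ae_all_iff.2 hXe] with ω hω
    exact Prod.ext rfl (funext hω)
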